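/- **Setting.** Let $Y$ be a real random variable, $X\in\{0,1\}$ and $W\in\mathbb R^d$, with known joint law $F_{Y,X,W}$; fix a regular conditional law of $(Y,X)$ given $W$. For $w\in\operatorname{supp}(W)$ put $p_{x|w}=P(X=x\mid W=w)$ and $F_{Y|X,W}(y\mid x,w)=P(Y\le y\mid X=x,W=w)$. Assume overlap: there is $\epsilon_0>0$ with $p_{1|w}\in[\epsilon_0,1-\epsilon_0]$ for all $w\in\operatorname{supp}(W)$. Let $c=(\underline c,\overline c)$ be functions of $w$ with $0<\underline c(w)\le p_{1|w}\le\overline c(w)<1$ for all $w\in\operatorname{supp}(W)$. Define $$\underline F_{Y_1|W}(y|w)=\max\Big\{F_{Y|X,W}(y|1,w)\tfrac{p_{1|w}}{\overline c(w)},\ \tfrac{\underline c(w)-p_{1|w}}{\underline c(w)}+F_{Y|X,W}(y|1,w)\tfrac{p_{1|w}}{\underline c(w)}\Big\},$$ $$\overline F_{Y_1|W}(y|w)=\min\Big\{F_{Y|X,W}(y|1,w)\tfrac{p_{1|w}}{\underline c(w)},\ \tfrac{\overline c(w)-p_{1|w}}{\overline c(w)}+F_{Y|X,W}(y|1,w)\tfrac{p_{1|w}}{\overline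 c(w)}\Big\},$$ $$\underline F_{Y_0|W}(y|w)=\max\Big\{F_{Y|X,W}(y|0,w)\tfrac{p_{0|w}}{1-\underline c(w)},\ \tfrac{p_{1|w}-\overline c(w)}{1-\overline c(w)}+F_{Y|X,W}(y|0,w)\tfrac{p_{0|w}}{1-\overline c(w)}\Big\},$$ $$\overline F_{Y_0|W}(y|w)=\min\Big\{F_{Y|X,W}(y|0,w)\tfrac{p_{0|w}}{1-\overline c(w)},\ \tfrac{p_{1|w}-\underline c(w)}{1-\underline c(w)}+F_{Y|X,W}(y|0,w)\tfrac{p_{0|w}}{1-\underline c(w)}\Big\}.$$ **Identified sets.** Let $\mathcal C_{1,0|X,W}$ be the set of all families $C=\{C_{1,0|x,w}\}_{x\in\{0,1\},\,w\in\operatorname{supp}(W)}$ of bivariate copulas. The set $\mathcal I^{\rm marg}(F_{Y,X,W};c)$ consists of the triples $(F_{Y_1|X,W},F_{Y_0|X,W},C)$ with $C\in\mathcal C_{1,0|X,W}$ for which there are probability laws $\widetilde P_w$ of $(Y_1,Y_0,X)$, $w\in\operatorname{supp}(W)$, such that for every $w\in\operatorname{supp}(W)$, $x\in\{0,1\}$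 and $y,y_1,y_0\in\mathbb R$: 1. $\widetilde P_w(Y_j\le y\mid X=x)=F_{Y_j|X,W}(y|x,w)$ for $j\in\{0,1\}$; 2. $\widetilde P_w(Y_1\le y_1,Y_0\le y_0\mid X=x)=C_{1,0|x,w}\big(F_{Y_1|X,W}(y_1|x,w),F_{Y_0|X,W}(y_0|x,w)\big)$; 3. $\widetilde P_w(X=x)=p_{x|w}$, $F_{Y_1|X,W}(y|1,w)=F_{Y|X,W}(y|1,w)$ and $F_{Y_0|X,W}(y|0,w)=F_{Y|X,W}(y|0,w)$ (compatibility with the data); 4. marginal $c$-dependence: $0<\underline c(w)\le\widetilde P_w(X=1)\le\overline c(w)<1$ and $\widetilde P_w(X=1\mid Y_x)\in[\underline c(w),\overline c(w)]$, $\widetilde P_w$-almost surely. The set $\mathcal I^{\rm marg}_0(F_{Y,X,W};c)$ for $(F_{Y_1|W},F_{Y_0|W},C)$ is the image of $\mathcal I^{\rm marg}(F_{Y,X,W};c)$ under $$F_{Y_x|W}(y|w)=F_{Y|X,W}(y|x,w)\,p_{x|w}+F_{Y_x|X,W}(y|1-x,w)\,p_{1-x|w},\qquad x\in\{0,1\}.$$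 **Theorem.** For all $(\varepsilon,\gamma)\in[0,1]^2$ and every $C\in\mathcal C_{1,0|X,W}$, $$\big(\varepsilon\underline F_{Y_1|W}+(1-\varepsilon)\overline F_{Y_1|W},\ \gamma\underline F_{Y_0|W}+(1-\gamma)\overline F_{Y_0|W},\ C\big)\in\mathcal I_0^{\rm marg}(F_{Y,X,W};c).$$ -/

import Mathlib

open MeasureTheory ProbabilityTheory Set

namespace CDep

/-- The covariate space `ℝ^d`. -/
abbrev Cov (d : ℕ) : Type := EuclideanSpace ℝ (Fin d)

/-- A bivariate copula: a function whose restriction to `[0,1]²` is the joint cdf of a random vector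
both of whose coordinates are uniform on `[0,1]`. (Values outside `[0,1]²` are irrelevant.) -/
def IsCopula (C : ℝ → ℝ → ℝ) : Prop :=
  ∃ μ : Measure (ℝ × ℝ), IsProbabilityMeasure μ ∧
    μ.fst = volume.restrict (Icc 0 1) ∧ μ.snd = volume.restrict (Icc 0 1) ∧
    ∀ u ∈ Icc (0 : ℝ) 1, ∀ v ∈ Icc (0 : ℝ) 1, C u v = μ.real (Iic u ×ˢ Iic v)

section Observed

/-! Observed side. `κw : Measure (ℝ × Bool)` is the law of `(Y, X)` given `W = w`, where the
treatment `X` is `true` for "treated" (`X = 1`) and `false` for "untreated" (`X = 0`). -/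

/-- The probability `p_{x|w} = P(X = x | W = w)`. -/
noncomputable def pr (κw : Measure (ℝ × Bool)) (x : Bool) : ℝ :=
  κw.real {z | z.2 = x}

/-- The conditional cdf `F_{Y|X,W}(y | x, w) = P(Y ≤ y | X = x, W = w)`. -/
noncomputable def obsCdf (κw : Measure (ℝ × Bool)) (x : Bool) (y : ℝ) : ℝ :=
  (ProbabilityTheory.cond κw {z | z.2 = x}).real {z | z.1 ≤ y}

/-- Lower envelope for the cdf of `Y₁` given `W = w`, with bounds `a ≤ p_{1|w} ≤ b`. -/
noncomputable def lowerF1 (κw : Measure (ℝ × Bool)) (a b y : ℝ) : ℝ :=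
  max (obsCdf κw true y * (pr κw true / b))
    ((a - pr κw true) / a + obsCdf κw true y * (pr κw true / a))

/-- Upper envelope for the cdf of `Y₁` given `W = w`. -/
noncomputable def upperF1 (κw : Measure (ℝ × Bool)) (a b y : ℝ) : ℝ :=
  min (obsCdf κw true y * (pr κw true / a))
    ((b - pr κw true) / b + obsCdf κw true y * (pr κw true / b))

/-- Lower envelope for the cdf of `Y₀` given `W = w`. -/
noncomputable def lowerF0 (κw : Measure (ℝ × Bool)) (a b y : ℝ) : ℝ :=
  max (obsCdf κw false y * (pr κw false / (1 - a)))
    ((pr κw true - b) / (1 - b) + obsCdf κw false y * (pr κw false / (1 - b)))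

/-- Upper envelope for the cdf of `Y₀` given `W = w`. -/
noncomputable def upperF0 (κw : Measure (ℝ × Bool)) (a b y : ℝ) : ℝ :=
  min (obsCdf κw false y * (pr κw false / (1 - b)))
    ((pr κw true - a) / (1 - a) + obsCdf κw false y * (pr κw false / (1 - a)))

end Observed

section Latent

/-! Latent side. A point of `ℝ × ℝ × Bool` is a value of `(Y₁, Y₀, X)`, and
`Q : Measure (ℝ × ℝ × Bool)` is a candidate law of `(Y₁, Y₀, X)` given `W = w`. -/

/-- The potential outcome `Y_x`. -/
def pot (x : Bool) (z : ℝ × ℝ × Bool) : ℝ := if x then z.1 else z.2.1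

/-- The event `X = x`. -/
def treat (x : Bool) : Set (ℝ × ℝ × Bool) := {z | z.2.2 = x}

/-- The latent propensity score `P(X = 1 | Y_x, W = w)`, the conditional probability under `Q` of
treatment given the σ-algebra generated by `Y_x`, as a random variable. -/
noncomputable def latentScore (Q : Measure (ℝ × ℝ × Bool)) (x : Bool) : ℝ × ℝ × Bool → ℝ :=
  Q[(treat true).indicator (fun _ => (1 : ℝ)) | MeasurableSpace.comap (pot x) inferInstance]

/-- The order requirement on the bounds at a covariate value: `0 < a ≤ p ≤ b < 1`. -/
def BoundsAt (p a b : ℝ) : Prop := 0 < a ∧ a ≤ p ∧ p ≤ b ∧ b < 1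

/-- Marginal `c`-dependence at a covariate value, for the law `Q` of `(Y₁, Y₀, X)` given `W = w`
and bounds `c = (a, b)`: the bounds are ordered around the propensity score, and both latent
propensity scores lie in `[a, b]` almost surely. -/
def MarginalCDependence (Q : Measure (ℝ × ℝ × Bool)) (a b : ℝ) : Prop :=
  BoundsAt (Q.real (treat true)) a b ∧
    ∀ x : Bool, ∀ᵐ z ∂Q, latentScore Q x z ∈ Icc a b

/-- The conditional cdf `F_{Y_j|X,W}(y | x, w) = P(Y_j ≤ y | X = x, W = w)`. -/
noncomputable def potCdf (Q : Measure (ℝ × ℝ × Bool)) (j x : Bool) (y : ℝ) : ℝ :=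
  (ProbabilityTheory.cond Q (treat x)).real {z | pot j z ≤ y}

/-- The conditional joint cdf
`F_{Y₁,Y₀|X,W}(y₁, y₀ | x, w) = P(Y₁ ≤ y₁, Y₀ ≤ y₀ | X = x, W = w)`. -/
noncomputable def jointCdf (Q : Measure (ℝ × ℝ × Bool)) (x : Bool) (y₁ y₀ : ℝ) : ℝ :=
  (ProbabilityTheory.cond Q (treat x)).real {z | pot true z ≤ y₁ ∧ pot false z ≤ y₀}

end Latent

section IdentifiedSet

variable {d : ℕ}

/-- The support of `W`, when `ρ` is the law of `(W, Y, X)`. -/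
abbrev supp (ρ : Measure (Cov d × ℝ × Bool)) : Set (Cov d) := ρ.fst.support

/-- Strict overlap: for some `e > 0`, `p_{1|w} ∈ [e, 1 - e]` for all `w` in the support of `W`. -/
def Overlap (ρ : Measure (Cov d × ℝ × Bool)) (κ : Kernel (Cov d) (ℝ × Bool)) : Prop :=
  ∃ e : ℝ, 0 < e ∧ ∀ w ∈ supp ρ, pr (κ w) true ∈ Icc e (1 - e)

/-- The families `{C_{1,0|x,w}}` of copulas indexed by `x ∈ {0,1}` and `w` in the support of `W`. -/
def copulaFamilies (ρ : Measure (Cov d × ℝ × Bool)) : Set (Bool → supp ρ → ℝ → ℝ → ℝ) :=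
  {C | ∀ x w, IsCopula (C x w)}

/-- The identified set for `(F_{Y₁|X,W}, F_{Y₀|X,W}, C_{1,0|X,W})` under marginal `c`-dependence
with bound functions `(a, b)`. Here `ρ` is the observed law of `(W, Y, X)` and `κ w` is the
conditional law of `(Y, X)` given `W = w`. A triple belongs to the set if there are laws `Q w` of
`(Y₁, Y₀, X)` given `W = w`, one for each `w` in the support of `W`, which
* have the triple as their conditional cdfs given `(X, W)` and conditional copulas,
* have the observed propensity score and are compatible with the observed cdfs of `Y` given `X, W`,
* satisfy marginal `c`-dependence. -/
def identifiedSet (ρ : Measure (Cov d × ℝ × Bool)) (κ : Kernel (Cov d) (ℝ × Bool))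
    (a b : Cov d → ℝ) :
    Set ((Bool → supp ρ → ℝ → ℝ) × (Bool → supp ρ → ℝ → ℝ) × (Bool → supp ρ → ℝ → ℝ → ℝ)) :=
  {T | T.2.2 ∈ copulaFamilies ρ ∧
    ∃ Q : supp ρ → Measure (ℝ × ℝ × Bool), ∀ w : supp ρ,
      IsProbabilityMeasure (Q w) ∧
      (∀ x y, T.1 x w y = potCdf (Q w) true x y) ∧
      (∀ x y, T.2.1 x w y = potCdf (Q w) false x y) ∧
      (∀ x y₁ y₀, jointCdf (Q w) x y₁ y₀ = T.2.2 x w (T.1 x w y₁) (T.2.1 x w y₀)) ∧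
      (∀ x, (Q w).real (treat x) = pr (κ w) x) ∧
      (∀ y, T.1 true w y = obsCdf (κ w) true y) ∧
      (∀ y, T.2.1 false w y = obsCdf (κ w) false y) ∧
      MarginalCDependence (Q w) (a w) (b w)}

/-- The identified set for `(F_{Y₁|W}, F_{Y₀|W}, C_{1,0|X,W})` under marginal `c`-dependence: the
image of `identifiedSet` under the affine relation
`F_{Y_x|W}(y | w) = F_{Y|X,W}(y | x, w) p_{x|w} + F_{Y_x|X,W}(y | 1 - x, w) p_{1-x|w}`. -/
def identifiedSet₀ (ρ : Measure (Cov d × ℝ × Bool)) (κ : Kernel (Cov d) (ℝ × Bool))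
    (a b : Cov d → ℝ) :
    Set ((supp ρ → ℝ → ℝ) × (supp ρ → ℝ → ℝ) × (Bool → supp ρ → ℝ → ℝ → ℝ)) :=
  (fun T => (fun w y => obsCdf (κ w) true y * pr (κ w) true + T.1 false w y * pr (κ w) false,
      fun w y => obsCdf (κ w) false y * pr (κ w) false + T.2.1 true w y * pr (κ w) true,
      T.2.2)) '' identifiedSet ρ κ a b

end IdentifiedSet

end CDep

/-! Everything happens at one fixed `w`. Write `p`, `q` for the probabilities of treatment and
non-treatment, and `μ` for the law of `Y` given `X = 1`. The data leave the law `ν` of `Y₁` given `X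
= 0` free. By Bayes, the score given `Y₁` is the density of `pμ` with respect to `pμ + qν`, so it
lies in `[a, b]` iff the cdf of `pμ + qν` has increments between `p/b` and `p/a` times those of the
cdf of `μ`. Both envelopes are piecewise linear functions of `u = F(y)` with exactly these slopes,
and mixing preserves the slope bounds (`envelopeMix_sub_mem`). Subtracting `pu` and dividing by `q`
then yields the cdf of an admissible `ν` (`exists_counterfactual`). `Y₀` is the same problem with
`X` flipped. Each score sees a single marginal, so the dependence between `Y₁` and `Y₀` is
unconstrained: Sklar's theorem (`IsCopula.exists_joint`) couples the marginals by any prescribed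
copula within each treatment arm. -/

namespace CDep

open Filter Topology
open scoped NNReal ENNReal

/-! ### Cdfs, quantiles and Sklar's theorem -/

section Cdf

/-- Domination of cdf increments gives domination of measures. -/
theorem smul_le_smul_of_cdf_sub_le (μ ν : Measure ℝ) [IsProbabilityMeasure μ]
    [IsProbabilityMeasure ν] (k l : ℝ≥0)
    (h : ∀ x y, x ≤ y → k * (cdf μ y - cdf μ x) ≤ l * (cdf ν y - cdf ν x)) :
    k • μ ≤ l • ν := by
  -- Inequalities on intervals do not extend by a π-λ argument. Instead, the monotone difference of
  -- the scaled cdfs is itself Stieltjes, and its measure is the gap between `k • μ` and `l • ν`.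
  let g : StieltjesFunction ℝ :=
    { toFun := fun x => l * cdf ν x - k * cdf μ x
      mono' := fun x y hxy => by
        have := h x y hxy
        dsimp only
        linarith
      right_continuous' := fun x =>
        (((cdf ν).right_continuous x).const_mul _).sub (((cdf μ).right_continuous x).const_mul _) }
  have hg : l • cdf ν = k • cdf μ + g := by
    ext x
    change (l : ℝ) * cdf ν x = k * cdf μ x + (l * cdf ν x - k * cdf μ x)
    ring
  have hm : (l • cdf ν).measure = (k • cdf μ).measure + g.measure := by
    rw [hg]
    exact StieltjesFunction.measure_add _ _
  rw [StieltjesFunction.measure_smul, StieltjesFunction.measure_smul, measure_cdf,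
    measure_cdf] at hm
  rw [hm]
  exact Measure.le_add_right le_rfl

theorem mul_real_le_mul_real_of_cdf_sub_le (μ ν : Measure ℝ) [IsProbabilityMeasure μ]
    [IsProbabilityMeasure ν] {k l : ℝ} (hk : 0 ≤ k) (hl : 0 ≤ l)
    (h : ∀ x y, x ≤ y → k * (cdf μ y - cdf μ x) ≤ l * (cdf ν y - cdf ν x)) (s : Set ℝ) :
    k * μ.real s ≤ l * ν.real s := by
  lift k to ℝ≥0 using hk
  lift l to ℝ≥0 using hl
  have := smul_le_smul_of_cdf_sub_le μ ν k l h s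
  have h2 := ENNReal.toReal_mono (measure_ne_top (l • ν) s) this
  rwa [← measureReal_def, ← measureReal_def, measureReal_nnreal_smul_apply,
    measureReal_nnreal_smul_apply] at h2

/-- A measurable generalized inverse of a cdf. -/
theorem exists_quantile (μ : Measure ℝ) :
    ∃ g : ℝ → ℝ, Measurable g ∧ ∀ u ∈ Ioo (0 : ℝ) 1, ∀ y, g u ≤ y ↔ u ≤ cdf μ y := by
  have key : ∀ u ∈ Ioo (0 : ℝ) 1, ∀ y, sInf {z | u ≤ cdf μ z} ≤ y ↔ u ≤ cdf μ y := by
    rintro u ⟨hu0, hu1⟩ y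
    have hne : {z | u ≤ cdf μ z}.Nonempty :=
      ((tendsto_cdf_atTop μ).eventually_const_le hu1).exists
    obtain ⟨m, hm⟩ := ((tendsto_cdf_atBot μ).eventually_lt_const hu0).exists
    have hbdd : BddBelow {z | u ≤ cdf μ z} :=
      ⟨m, fun z hz => le_of_not_gt fun hzm =>
        absurd (hz.trans (monotone_cdf μ hzm.le)) (not_le.2 hm)⟩
    refine ⟨fun h => ?_, fun h => csInf_le hbdd h⟩
    refine le_trans ?_ (monotone_cdf μ h)
    -- Right continuity puts the infimum itself in the superlevel set.
    rw [← (cdf μ).iInf_Ioi_eq]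
    refine le_ciInf fun r => ?_
    obtain ⟨s, hs, hsr⟩ := exists_lt_of_csInf_lt hne r.2
    exact le_trans hs (monotone_cdf μ hsr.le)
  classical
  -- Outside `(0, 1)` the superlevel set can be empty or unbounded below; the default 0 there is
  -- harmless, since a uniform variable almost surely avoids those values.
  refine ⟨fun u => if u ∈ Ioo (0 : ℝ) 1 then sInf {z | u ≤ cdf μ z} else 0, ?_, ?_⟩
  · refine measurable_of_Iic fun y => ?_
    have : (fun u => if u ∈ Ioo (0 : ℝ) 1 then sInf {z | u ≤ cdf μ z} else 0) ⁻¹' Iic y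
        = (Ioo 0 1 ∩ Iic (cdf μ y)) ∪ ((Ioo 0 1)ᶜ ∩ {_u | 0 ≤ y}) := by
      ext u
      by_cases hu : u ∈ Ioo (0 : ℝ) 1
      · simpa [-mem_Ioo, hu] using key u hu y
      · simp [-mem_Ioo, hu]
    rw [this]
    exact (measurableSet_Ioo.inter measurableSet_Iic).union
      (measurableSet_Ioo.compl.inter (MeasurableSet.const _))
  · intro u hu y
    simp only [if_pos hu, key u hu y]

theorem ae_mem_Ioo_of_map_eq_uniform {α : Type*} [MeasurableSpace α] {π : Measure α} {f : α → ℝ}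
    (hf : Measurable f) (h : π.map f = volume.restrict (Icc 0 1)) :
    ∀ᵐ z ∂π, f z ∈ Ioo (0 : ℝ) 1 := by
  refine ae_of_ae_map hf.aemeasurable ?_
  rw [h, ← restrict_Ioo_eq_restrict_Icc]
  exact ae_restrict_mem measurableSet_Ioo

/-- The inverse transform: a quantile function maps a uniform variable to the given law. -/
theorem map_quantile_eq {α : Type*} [MeasurableSpace α] {π : Measure α} {f : α → ℝ}
    (hf : Measurable f) (h : π.map f = volume.restrict (Icc 0 1)) [IsProbabilityMeasure π]
    (μ : Measure ℝ) [IsProbabilityMeasure μ] {g : ℝ → ℝ} (hg : Measurable g)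
    (hgμ : ∀ u ∈ Ioo (0 : ℝ) 1, ∀ y, g u ≤ y ↔ u ≤ cdf μ y) :
    π.map (fun z => g (f z)) = μ := by
  have : IsProbabilityMeasure (π.map fun z => g (f z)) :=
    Measure.isProbabilityMeasure_map (hg.comp hf).aemeasurable
  refine Measure.ext_of_Iic _ _ fun y => ?_
  have hgf : Measurable fun z => g (f z) := hg.comp hf
  rw [Measure.map_apply hgf measurableSet_Iic]
  have h1 : (fun z => g (f z)) ⁻¹' Iic y =ᵐ[π] f ⁻¹' Iic (cdf μ y) := by
    filter_upwards [ae_mem_Ioo_of_map_eq_uniform hf h] with z hz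
    exact propext (hgμ _ hz y)
  rw [measure_congr h1, ← Measure.map_apply hf measurableSet_Iic, h,
    Measure.restrict_apply measurableSet_Iic, ← ofReal_cdf μ y]
  have : Iic (cdf μ y) ∩ Icc 0 1 = Icc 0 (cdf μ y) := by
    ext u
    have := cdf_le_one μ y
    simp only [mem_inter_iff, mem_Iic, mem_Icc]
    constructor
    · rintro ⟨h1, h2, -⟩
      exact ⟨h2, h1⟩
    · rintro ⟨h1, h2⟩
      exact ⟨h2, h1, h2.trans this⟩
  rw [this, Real.volume_Icc, sub_zero]

/-- Sklar's theorem, existence of a joint law with given marginals and copula. -/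
theorem IsCopula.exists_joint {C : ℝ → ℝ → ℝ} (hC : IsCopula C) (α β : Measure ℝ)
    [IsProbabilityMeasure α] [IsProbabilityMeasure β] :
    ∃ J : Measure (ℝ × ℝ), IsProbabilityMeasure J ∧ J.fst = α ∧ J.snd = β ∧
      ∀ y z, J.real (Iic y ×ˢ Iic z) = C (α.real (Iic y)) (β.real (Iic z)) := by
  obtain ⟨π, hπ, h1, h2, hCπ⟩ := hC
  obtain ⟨g, hg, hgα⟩ := exists_quantile α
  obtain ⟨k, hk, hkβ⟩ := exists_quantile β
  have hm : Measurable fun z : ℝ × ℝ => (g z.1, k z.2) :=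
    (hg.comp measurable_fst).prodMk (hk.comp measurable_snd)
  refine ⟨π.map fun z => (g z.1, k z.2), Measure.isProbabilityMeasure_map hm.aemeasurable,
    ?_, ?_, fun y z => ?_⟩
  · rw [Measure.fst, Measure.map_map measurable_fst hm]
    exact map_quantile_eq measurable_fst h1 α hg hgα
  · rw [Measure.snd, Measure.map_map measurable_snd hm]
    exact map_quantile_eq measurable_snd h2 β hk hkβ
  · rw [map_measureReal_apply hm (measurableSet_Iic.prod measurableSet_Iic), ← cdf_eq_real,
      ← cdf_eq_real, hCπ _ ⟨cdf_nonneg _ _, cdf_le_one _ _⟩ _ ⟨cdf_nonneg _ _, cdf_le_one _ _⟩]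
    -- The quantile equivalence identifies the two rectangles up to a null set, so atoms of `α` and
    -- `β` cause no trouble.
    refine measureReal_congr ?_
    filter_upwards [ae_mem_Ioo_of_map_eq_uniform measurable_fst h1,
      ae_mem_Ioo_of_map_eq_uniform measurable_snd h2] with x hx1 hx2
    exact propext (and_congr (hgα _ hx1 y) (hkβ _ hx2 z))

end Cdf

/-! ### Envelopes and the counterfactual law -/

section Envelope

/-- The mixture, with weight `e`, of the two piecewise linear envelopes. -/
noncomputable def envelopeMix (p a b e u : ℝ) : ℝ :=
  e * max (u * (p / b)) ((a - p) / a + u * (p / a))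
    + (1 - e) * min (u * (p / a)) ((b - p) / b + u * (p / b))

variable {p a b e : ℝ}

theorem continuous_envelopeMix : Continuous (envelopeMix p a b e) := by
  unfold envelopeMix
  fun_prop

theorem envelopeMix_zero (ha : 0 < a) (hap : a ≤ p) (hpb : p ≤ b) : envelopeMix p a b e 0 = 0 := by
  have h1 : (a - p) / a ≤ 0 := div_nonpos_of_nonpos_of_nonneg (by linarith) ha.le
  have h2 : 0 ≤ (b - p) / b := div_nonneg (by linarith) (by linarith)
  simp [envelopeMix, h1, h2]

theorem envelopeMix_one (ha : 0 < a) (hap : a ≤ p) (hpb : p ≤ b) : envelopeMix p a b e 1 = 1 := by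
  have hb : 0 < b := by linarith
  have h1 : (a - p) / a + 1 * (p / a) = 1 := by field_simp; ring
  have h2 : (b - p) / b + 1 * (p / b) = 1 := by field_simp; ring
  have h3 : 1 * (p / b) ≤ 1 := by rw [one_mul, div_le_one hb]; exact hpb
  have h4 : 1 ≤ 1 * (p / a) := by rw [one_mul, one_le_div ha]; exact hap
  simp only [envelopeMix, h1, h2, max_eq_right h3, min_eq_right h4]
  ring

/-- Each envelope has only the slopes `p/b ≤ p/a`, and convex combinations keep two-sided increment
bounds. This is `c`-dependence in cdf form. -/
theorem envelopeMix_sub_mem (ha : 0 < a) (hap : a ≤ p) (hpb : p ≤ b) (he : e ∈ Icc (0 : ℝ) 1)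
    {u v : ℝ} (huv : u ≤ v) :
    envelopeMix p a b e v - envelopeMix p a b e u ∈ Icc (p / b * (v - u)) (p / a * (v - u)) := by
  have hkl : p / b ≤ p / a := div_le_div_of_nonneg_left (by linarith) ha (hap.trans hpb)
  unfold envelopeMix
  generalize p / a = l at *
  generalize p / b = k at *
  generalize (a - p) / a = c
  generalize (b - p) / b = d
  have hd : k * (v - u) ≤ l * (v - u) := mul_le_mul_of_nonneg_right hkl (by linarith)
  have hmax : max (v * k) (c + v * l) - max (u * k) (c + u * l)
      ∈ Icc (k * (v - u)) (l * (v - u)) := by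
    rcases max_cases (v * k) (c + v * l) with h | h <;>
    rcases max_cases (u * k) (c + u * l) with h' | h' <;>
    constructor <;> linarith
  have hmin : min (v * l) (d + v * k) - min (u * l) (d + u * k)
      ∈ Icc (k * (v - u)) (l * (v - u)) := by
    rcases min_cases (v * l) (d + v * k) with h | h <;>
    rcases min_cases (u * l) (d + u * k) with h' | h' <;>
    constructor <;> linarith
  obtain ⟨he0, he1⟩ := he
  have he1' : 0 ≤ 1 - e := by linarith
  have A := mul_le_mul_of_nonneg_left hmax.1 he0
  have B := mul_le_mul_of_nonneg_left hmax.2 he0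
  have A' := mul_le_mul_of_nonneg_left hmin.1 he1'
  have B' := mul_le_mul_of_nonneg_left hmin.2 he1'
  constructor <;> linarith

/-- A counterfactual law `ν` for which the mixture `p • μ + q • ν` has the prescribed envelope
mixture as its cdf, with the density of `p • μ` relative to it between `a` and `b`. -/
theorem exists_counterfactual (μ : Measure ℝ) [IsProbabilityMeasure μ] {q : ℝ}
    (hp : BoundsAt p a b) (hpq : p + q = 1) (he : e ∈ Icc (0 : ℝ) 1) :
    ∃ ν : Measure ℝ, IsProbabilityMeasure ν ∧
      (∀ y, envelopeMix p a b e (μ.real (Iic y)) = μ.real (Iic y) * p + ν.real (Iic y) * q) ∧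
      ∀ s, p * μ.real s ∈ Icc (a * (p * μ.real s + q * ν.real s))
        (b * (p * μ.real s + q * ν.real s)) := by
  obtain ⟨ha, hap, hpb, hb1⟩ := hp
  have hq : 0 < q := by linarith
  have hb : 0 < b := by linarith
  have hp0 : 0 < p := by linarith
  -- Since `b < 1`, even the smallest slope is at least `p`, so removing the observed part `pu`
  -- leaves a monotone function.
  have hkp : p ≤ p / b := by rw [le_div_iff₀ hb]; nlinarith
  -- Solves the law of total probability, envelope `= pu + qψ(u)`, for the counterfactual cdf.
  set ψ : ℝ → ℝ := fun u => (envelopeMix p a b e u - p * u) / q with hψ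
  have hψc : Continuous ψ := by
    have := @continuous_envelopeMix p a b e
    fun_prop
  have hψ0 : ψ 0 = 0 := by simp [hψ, envelopeMix_zero ha hap hpb]
  have hψ1 : ψ 1 = 1 := by
    simp only [hψ, envelopeMix_one ha hap hpb]
    rw [div_eq_one_iff_eq hq.ne']
    linarith
  have hinc : ∀ u v, u ≤ v → (p / b - p) * (v - u) ≤ q * (ψ v - ψ u) ∧
      q * (ψ v - ψ u) ≤ (p / a - p) * (v - u) := by
    intro u v huv
    have h := envelopeMix_sub_mem ha hap hpb he huv
    have : q * (ψ v - ψ u)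
        = envelopeMix p a b e v - envelopeMix p a b e u - p * (v - u) := by
      simp only [hψ]
      field_simp
      ring
    rw [this]
    constructor <;> linarith [h.1, h.2]
  have hψm : Monotone ψ := fun u v huv => by
    have h1 := (hinc u v huv).1
    have h2 : 0 ≤ (p / b - p) * (v - u) := mul_nonneg (by linarith) (by linarith)
    have := nonneg_of_mul_nonneg_right (h2.trans h1) hq
    linarith
  let f : StieltjesFunction ℝ :=
    { toFun := fun y => ψ (cdf μ y)
      mono' := hψm.comp (monotone_cdf μ)
      right_continuous' := fun y =>
        hψc.continuousAt.comp_continuousWithinAt ((cdf μ).right_continuous y) }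
  have hf0 : Tendsto f atBot (𝓝 0) := by
    have := (hψc.tendsto 0).comp (tendsto_cdf_atBot μ)
    rwa [hψ0] at this
  have hf1 : Tendsto f atTop (𝓝 1) := by
    have := (hψc.tendsto 1).comp (tendsto_cdf_atTop μ)
    rwa [hψ1] at this
  have hν : IsProbabilityMeasure f.measure := f.isProbabilityMeasure hf0 hf1
  have hcdf : ∀ y, cdf f.measure y = ψ (cdf μ y) := fun y => by
    rw [cdf_measure_stieltjesFunction f hf0 hf1]
  refine ⟨f.measure, hν, fun y => ?_, fun s => ?_⟩
  · rw [← cdf_eq_real, ← cdf_eq_real, hcdf]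
    simp only [hψ]
    field_simp
    ring
  -- A lower bound on `ν` is the upper score bound: `pμ ≤ b(pμ + qν)` rearranged. Likewise `hup`
  -- below is the lower score bound.
  · have hlow : p * (1 - b) * μ.real s ≤ b * q * f.measure.real s := by
      refine mul_real_le_mul_real_of_cdf_sub_le _ _ (by nlinarith) (by positivity)
        (fun x y hxy => ?_) s
      rw [hcdf, hcdf]
      have := mul_le_mul_of_nonneg_left (hinc _ _ (monotone_cdf μ hxy)).1 hb.le
      have e1 : b * (p / b) = p := by field_simp
      linear_combination this - (cdf μ y - cdf μ x) * e1
    have hup : a * q * f.measure.real s ≤ p * (1 - a) * μ.real s := by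
      refine mul_real_le_mul_real_of_cdf_sub_le _ _ (by positivity) (by nlinarith)
        (fun x y hxy => ?_) s
      rw [hcdf, hcdf]
      have := mul_le_mul_of_nonneg_left (hinc _ _ (monotone_cdf μ hxy)).2 ha.le
      have e1 : a * (p / a) = p := by field_simp
      linear_combination this + (cdf μ y - cdf μ x) * e1
    constructor <;> linarith

end Envelope

/-! ### Bounds on conditional probabilities -/

section Score

/-- A conditional probability lies in `[a, b]` almost surely as soon as it does so on average over
every event of the conditioning σ-algebra. -/
theorem condExp_indicator_mem_Icc {Ω : Type*} {m mΩ : MeasurableSpace Ω} (hm : m ≤ mΩ)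
    (Q : Measure Ω) [IsProbabilityMeasure Q] {A : Set Ω} (hA : MeasurableSet A) {a b : ℝ}
    (h : ∀ s, MeasurableSet[m] s → Q.real (s ∩ A) ∈ Icc (a * Q.real s) (b * Q.real s)) :
    ∀ᵐ z ∂Q, (Q[A.indicator (fun _ => (1 : ℝ)) | m]) z ∈ Icc a b := by
  have hfi : Integrable (A.indicator fun _ => (1 : ℝ)) Q := (integrable_const _).indicator hA
  -- The comparison is made under `Q.trim hm`, where the measurable test sets are exactly those of
  -- `m`.
  have hci : Integrable (Q[A.indicator (fun _ => (1 : ℝ)) | m]) (Q.trim hm) :=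
    integrable_condExp.trim hm stronglyMeasurable_condExp
  have hset : ∀ s, MeasurableSet[m] s →
      ∫ z in s, (Q[A.indicator (fun _ => (1 : ℝ)) | m]) z ∂Q.trim hm = Q.real (s ∩ A) := by
    intro s hs
    rw [← setIntegral_trim hm stronglyMeasurable_condExp hs, setIntegral_condExp hm hfi hs,
      setIntegral_indicator hA]
    simp
  have hconst : ∀ c : ℝ, ∀ s, MeasurableSet[m] s → ∫ _z in s, c ∂Q.trim hm = c * Q.real s := by
    intro c s hs
    rw [setIntegral_const, smul_eq_mul, mul_comm, measureReal_def, measureReal_def,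
      trim_measurableSet_eq hm hs]
  have hlow : (fun _ => a) ≤ᵐ[Q.trim hm] Q[A.indicator (fun _ => (1 : ℝ)) | m] :=
    ae_le_of_forall_setIntegral_le (integrable_const _) hci fun s hs _ => by
      rw [hset s hs, hconst a s hs]
      exact (h s hs).1
  have hup : Q[A.indicator (fun _ => (1 : ℝ)) | m] ≤ᵐ[Q.trim hm] fun _ => b :=
    ae_le_of_forall_setIntegral_le hci (integrable_const _) fun s hs _ => by
      rw [hset s hs, hconst b s hs]
      exact (h s hs).2
  filter_upwards [ae_of_ae_trim hm hlow, ae_of_ae_trim hm hup] with z h1 h2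
  exact ⟨h1, h2⟩

end Score

/-! ### Gluing the two treatment arms -/

section Mixture

/-- The point `(Y₁, Y₀, X)` with treatment `x`. -/
def withTreat (x : Bool) (z : ℝ × ℝ) : ℝ × ℝ × Bool := (z.1, z.2, x)

theorem measurable_withTreat (x : Bool) : Measurable (withTreat x) := by
  unfold withTreat
  fun_prop

theorem measurableSet_treat (x : Bool) : MeasurableSet (treat x) :=
  (measurable_snd.comp measurable_snd) (measurableSet_singleton x)

theorem measurable_pot (x : Bool) : Measurable (pot x) := by
  cases x
  · exact measurable_fst.comp measurable_snd
  · exact measurable_fst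

/-- The law of `(Y₁, Y₀, X)` with `P(X = x) = r x` and conditional law `J x` of `(Y₁, Y₀)` given
`X = x`. -/
noncomputable def treatMixture (r : Bool → ℝ≥0) (J : Bool → Measure (ℝ × ℝ)) :
    Measure (ℝ × ℝ × Bool) :=
  r true • (J true).map (withTreat true) + r false • (J false).map (withTreat false)

variable {r : Bool → ℝ≥0} {J : Bool → Measure (ℝ × ℝ)}

theorem treatMixture_inter_treat (x : Bool) {s : Set (ℝ × ℝ × Bool)} (hs : MeasurableSet s) :
    treatMixture r J (treat x ∩ s) = r x * J x (withTreat x ⁻¹' s) := by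
  have hm := (measurableSet_treat x).inter hs
  rw [treatMixture, Measure.add_apply, Measure.smul_apply, Measure.smul_apply,
    Measure.map_apply (measurable_withTreat _) hm, Measure.map_apply (measurable_withTreat _) hm]
  have h1 : ∀ y, withTreat y ⁻¹' (treat x ∩ s) = {z | y = x ∧ withTreat y z ∈ s} := fun y => rfl
  rw [h1, h1]
  cases x <;> simp [ENNReal.smul_def, preimage]

theorem real_treatMixture_inter_treat (x : Bool) {s : Set (ℝ × ℝ × Bool)} (hs : MeasurableSet s) :
    (treatMixture r J).real (treat x ∩ s) = r x * (J x).real (withTreat x ⁻¹' s) := by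
  simp [measureReal_def, treatMixture_inter_treat x hs]

variable [∀ x, IsProbabilityMeasure (J x)]

theorem treatMixture_treat (x : Bool) : treatMixture r J (treat x) = r x := by
  have := treatMixture_inter_treat (r := r) (J := J) x MeasurableSet.univ
  simpa using this

instance : IsFiniteMeasure (treatMixture r J) := by
  unfold treatMixture
  infer_instance

theorem isProbabilityMeasure_treatMixture (hr : r true + r false = 1) :
    IsProbabilityMeasure (treatMixture r J) := by
  constructor
  rw [treatMixture, Measure.add_apply, Measure.smul_apply, Measure.smul_apply,
    Measure.map_apply (measurable_withTreat _) MeasurableSet.univ,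
    Measure.map_apply (measurable_withTreat _) MeasurableSet.univ]
  simp only [preimage_univ, measure_univ, ENNReal.smul_def, smul_eq_mul, mul_one]
  exact_mod_cast hr

theorem real_treatMixture {s : Set (ℝ × ℝ × Bool)} (hs : MeasurableSet s) :
    (treatMixture r J).real s = r true * (J true).real (withTreat true ⁻¹' s)
      + r false * (J false).real (withTreat false ⁻¹' s) := by
  rw [← real_treatMixture_inter_treat true hs, ← real_treatMixture_inter_treat false hs,
    ← measureReal_inter_add_sdiff (s := s) (measurableSet_treat true), inter_comm]
  congr 2
  ext z
  simp [treat, and_comm]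

theorem cond_real_treatMixture {x : Bool} (hx : r x ≠ 0) {s : Set (ℝ × ℝ × Bool)}
    (hs : MeasurableSet s) :
    (ProbabilityTheory.cond (treatMixture r J) (treat x)).real s
      = (J x).real (withTreat x ⁻¹' s) := by
  rw [measureReal_def, cond_apply (measurableSet_treat x), treatMixture_treat,
    treatMixture_inter_treat x hs, ← mul_assoc, ENNReal.inv_mul_cancel (by simpa using hx) (by simp),
    one_mul, measureReal_def]

theorem real_withTreat_preimage_pot {ν : Measure (ℝ × ℝ)} (x : Bool) {s : Set ℝ}
    (hs : MeasurableSet s) (j : Bool) :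
    ν.real (withTreat x ⁻¹' (pot j ⁻¹' s)) = if j then ν.fst.real s else ν.snd.real s := by
  cases j
  · simp only [Bool.false_eq_true, if_false, measureReal_def, Measure.snd_apply hs]
    rfl
  · simp only [if_true, measureReal_def, Measure.fst_apply hs]
    rfl

/-- Both latent propensity scores are controlled through the marginals of the conditional laws. -/
theorem latentScore_treatMixture_mem (hr : r true + r false = 1) {a b : ℝ} (j : Bool)
    (h : ∀ s : Set ℝ, MeasurableSet s →
      r true * (if j then (J true).fst.real s else (J true).snd.real s) ∈ Icc
        (a * (r true * (if j then (J true).fst.real s else (J true).snd.real s)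
          + r false * (if j then (J false).fst.real s else (J false).snd.real s)))
        (b * (r true * (if j then (J true).fst.real s else (J true).snd.real s)
          + r false * (if j then (J false).fst.real s else (J false).snd.real s)))) :
    ∀ᵐ z ∂treatMixture r J, latentScore (treatMixture r J) j z ∈ Icc a b := by
  have := isProbabilityMeasure_treatMixture (J := J) hr
  refine condExp_indicator_mem_Icc (measurable_pot j).comap_le _ (measurableSet_treat true) ?_
  -- Events generated by `Y_j` are preimages under `pot j`, so only the `j`-th marginals enter and
  -- the coupling drops out.
  rintro _ ⟨s, hs, rfl⟩
  have hps := measurable_pot j hs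
  rw [inter_comm, real_treatMixture_inter_treat _ hps, real_treatMixture hps,
    real_withTreat_preimage_pot _ hs, real_withTreat_preimage_pot _ hs]
  exact h s hs

end Mixture

/-! ### The observed law -/

section Observed

variable (P : Measure (ℝ × Bool))

theorem measurableSet_snd_eq (x : Bool) : MeasurableSet {z : ℝ × Bool | z.2 = x} :=
  measurable_snd (measurableSet_singleton x)

theorem pr_true_add_pr_false [IsProbabilityMeasure P] : pr P true + pr P false = 1 := by
  have : {z : ℝ × Bool | z.2 = false} = {z : ℝ × Bool | z.2 = true}ᶜ := by
    ext z
    simp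
  rw [pr, pr, this, probReal_add_probReal_compl (measurableSet_snd_eq true)]

/-- The conditional law of `Y` given `X = x`. -/
noncomputable def obsLaw (x : Bool) : Measure ℝ :=
  (ProbabilityTheory.cond P {z | z.2 = x}).fst

theorem obsCdf_eq_obsLaw (x : Bool) (y : ℝ) : obsCdf P x y = (obsLaw P x).real (Iic y) := by
  rw [obsLaw, measureReal_def, Measure.fst_apply measurableSet_Iic]
  rfl

theorem isProbabilityMeasure_obsLaw [IsProbabilityMeasure P] {x : Bool} (hx : pr P x ≠ 0) :
    IsProbabilityMeasure (obsLaw P x) := by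
  have : IsProbabilityMeasure (ProbabilityTheory.cond P {z | z.2 = x}) :=
    cond_isProbabilityMeasure fun h0 => hx (by simp [pr, measureReal_def, h0])
  unfold obsLaw
  infer_instance

end Observed

/-! ### Assembly -/

/-- At a fixed covariate value: a law of `(Y₁, Y₀, X)` with the given conditional copulas that is
compatible with the data, satisfies marginal `c`-dependence, and has the prescribed envelope
mixtures as the cdfs of `Y₁` and `Y₀`. -/
theorem exists_latent_law (P : Measure (ℝ × Bool)) [IsProbabilityMeasure P] {a b ε γ : ℝ}
    (hB : BoundsAt (pr P true) a b) (hε : ε ∈ Icc (0 : ℝ) 1) (hγ : γ ∈ Icc (0 : ℝ) 1)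
    {C : Bool → ℝ → ℝ → ℝ} (hC : ∀ x, IsCopula (C x)) :
    ∃ Q : Measure (ℝ × ℝ × Bool), IsProbabilityMeasure Q ∧
      (∀ x y₁ y₀, jointCdf Q x y₁ y₀ = C x (potCdf Q true x y₁) (potCdf Q false x y₀)) ∧
      (∀ x, Q.real (treat x) = pr P x) ∧
      (∀ y, potCdf Q true true y = obsCdf P true y) ∧
      (∀ y, potCdf Q false false y = obsCdf P false y) ∧
      MarginalCDependence Q a b ∧
      (∀ y, ε * lowerF1 P a b y + (1 - ε) * upperF1 P a b y
        = obsCdf P true y * pr P true + potCdf Q true false y * pr P false) ∧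
      (∀ y, γ * lowerF0 P a b y + (1 - γ) * upperF0 P a b y
        = obsCdf P false y * pr P false + potCdf Q false true y * pr P true) := by
  have hpq := pr_true_add_pr_false P
  have hp : 0 < pr P true := hB.1.trans_le hB.2.1
  have hq : 0 < pr P false := by linarith [hB.2.2.1, hB.2.2.2]
  -- For `Y₀` the arms exchange roles: the probability of `X = 0` is to lie in `[1 - b, 1 - a]`.
  have hB' : BoundsAt (pr P false) (1 - b) (1 - a) := by
    obtain ⟨h1, h2, h3, h4⟩ := hB
    refine ⟨?_, ?_, ?_, ?_⟩ <;> linarith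
  have := isProbabilityMeasure_obsLaw P hp.ne'
  have := isProbabilityMeasure_obsLaw P hq.ne'
  obtain ⟨ν₁, _, hν₁, hs₁⟩ := exists_counterfactual (obsLaw P true) hB hpq hε
  obtain ⟨ν₀, _, hν₀, hs₀⟩ := exists_counterfactual (obsLaw P false) hB'
    ((add_comm _ _).trans hpq) hγ
  -- Each arm pairs its observed law with the counterfactual law of the other outcome.
  obtain ⟨J₁, hJ₁, hJ₁f, hJ₁s, hJ₁C⟩ := (hC true).exists_joint (obsLaw P true) ν₀
  obtain ⟨J₀, hJ₀, hJ₀f, hJ₀s, hJ₀C⟩ := (hC false).exists_joint ν₁ (obsLaw P false)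
  let J : Bool → Measure (ℝ × ℝ) := fun x => if x then J₁ else J₀
  have hJ : ∀ x, IsProbabilityMeasure (J x) := by
    rintro (_ | _) <;> assumption
  let r : Bool → ℝ≥0 := fun x => (pr P x).toNNReal
  have hr : ∀ x, (r x : ℝ) = pr P x := fun x => Real.coe_toNNReal _ measureReal_nonneg
  have hr0 : ∀ x, r x ≠ 0 := by
    intro x h
    have := hr x
    rw [h] at this
    cases x
    · exact hq.ne this
    · exact hp.ne this
  have hr1 : r true + r false = 1 := by
    rw [← NNReal.coe_inj]
    push_cast
    rw [hr, hr, hpq]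
  have hpot : ∀ j x y, potCdf (treatMixture r J) j x y
      = if j then (J x).fst.real (Iic y) else (J x).snd.real (Iic y) := by
    intro j x y
    rw [potCdf, ← real_withTreat_preimage_pot x measurableSet_Iic,
      ← cond_real_treatMixture (hr0 x) (measurable_pot j measurableSet_Iic)]
    rfl
  have hjoint : ∀ x y₁ y₀, jointCdf (treatMixture r J) x y₁ y₀
      = (J x).real (Iic y₁ ×ˢ Iic y₀) := by
    intro x y₁ y₀
    rw [jointCdf]
    exact cond_real_treatMixture (hr0 x) ((measurable_pot true measurableSet_Iic).inter
      (measurable_pot false measurableSet_Iic))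
  have htreat : ∀ x, (treatMixture r J).real (treat x) = pr P x := fun x => by
    rw [measureReal_def, treatMixture_treat, ENNReal.coe_toReal, hr]
  refine ⟨treatMixture r J, isProbabilityMeasure_treatMixture hr1, ?_, htreat, ?_, ?_, ⟨?_, ?_⟩,
    ?_, ?_⟩
  · rintro (_ | _) y₁ y₀
    · simp [-Iic_prod_Iic, hpot, hjoint, J, hJ₀C, hJ₀f, hJ₀s]
    · simp [-Iic_prod_Iic, hpot, hjoint, J, hJ₁C, hJ₁f, hJ₁s]
  · intro y
    simp [hpot, J, hJ₁f, obsCdf_eq_obsLaw]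
  · intro y
    simp [hpot, J, hJ₀s, obsCdf_eq_obsLaw]
  · rwa [htreat]
  · rintro (_ | _) <;> refine latentScore_treatMixture_mem hr1 _ fun s _ => ?_
    · simp only [hr, J, if_true, Bool.false_eq_true, if_false, hJ₁s, hJ₀s]
      -- `hs₀` bounds the untreated share; complementing gives `[a, b]` for the treated one.
      obtain ⟨h1, h2⟩ := hs₀ s
      constructor <;> linarith
    · simp only [hr, J, if_true, Bool.false_eq_true, if_false, hJ₁f, hJ₀f]
      exact hs₁ s
  · intro y
    simp only [hpot, J, if_true, Bool.false_eq_true, if_false, hJ₀f, obsCdf_eq_obsLaw, lowerF1,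
      upperF1]
    exact hν₁ y
  · intro y
    simp only [hpot, J, if_true, hJ₁s, Bool.false_eq_true, if_false, obsCdf_eq_obsLaw, lowerF0,
      upperF0]
    rw [← hν₀ y, envelopeMix, show 1 - b - pr P false = pr P true - b by linarith,
      show 1 - a - pr P false = pr P true - a by linarith]

end CDep

/-- Sharpness of the cdf envelopes under marginal `c`-dependence. `ρ` is the law of the observables
`(W, Y, X)` and `κ` is a regular conditional distribution of `(Y, X)` given `W`. -/
theorem mainTheorem1 {d : ℕ}
    (ρ : Measure (CDep.Cov d × ℝ × Bool)) [IsProbabilityMeasure ρ]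
    (κ : Kernel (CDep.Cov d) (ℝ × Bool)) [IsMarkovKernel κ] [ρ.IsCondKernel κ]
    (cLow cUp : CDep.Cov d → ℝ)
    (hOverlap : CDep.Overlap ρ κ)
    (hBounds : ∀ w ∈ CDep.supp ρ, CDep.BoundsAt (CDep.pr (κ w) true) (cLow w) (cUp w))
    (ε γ : ℝ) (hε : ε ∈ Icc (0 : ℝ) 1) (hγ : γ ∈ Icc (0 : ℝ) 1)
    (C : Bool → CDep.supp ρ → ℝ → ℝ → ℝ) (hC : C ∈ CDep.copulaFamilies ρ) :
    ((fun w y => ε * CDep.lowerF1 (κ w) (cLow w) (cUp w) y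
        + (1 - ε) * CDep.upperF1 (κ w) (cLow w) (cUp w) y,
      fun w y => γ * CDep.lowerF0 (κ w) (cLow w) (cUp w) y
        + (1 - γ) * CDep.upperF0 (κ w) (cLow w) (cUp w) y,
      C) : (CDep.supp ρ → ℝ → ℝ) × (CDep.supp ρ → ℝ → ℝ) ×
        (Bool → CDep.supp ρ → ℝ → ℝ → ℝ)) ∈ CDep.identifiedSet₀ ρ κ cLow cUp := by
  -- The identified set imposes no measurability in `w`, so laws may be chosen pointwise.
  choose Q hQ hjoint htreat h1 h0 hdep henv1 henv0 using fun w : CDep.supp ρ =>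
    CDep.exists_latent_law (κ w) (hBounds w w.2) hε hγ (C := fun x => C x w) (fun x => hC x w)
  refine ⟨(fun x w y => CDep.potCdf (Q w) true x y, fun x w y => CDep.potCdf (Q w) false x y, C),
    ⟨hC, Q, fun w => ⟨hQ w, fun _ _ => rfl, fun _ _ => rfl, hjoint w, htreat w, h1 w, h0 w,
      hdep w⟩⟩, ?_⟩
  refine Prod.ext ?_ (Prod.ext ?_ rfl)
  · funext w y
    exact (henv1 w y).symm
  · funext w y
    exact (henv0 w y).symm
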